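/- Let $\mathbb{K}$ be a field of characteristic zero (for instance $\mathbb{R}$ or $\mathbb{C}$), let $\ell\ge 1$ and $n\geq 0$ be integers, and let $X=(x_{ij})$, $1\le i\le \ell$, $1\le j\le n$, be a matrix of independent commuting variables. The group $\mathfrak{S}_n\times GL_\ell(\mathbb{K})$ acts on $\mathbb{K}[X]$ by $(\sigma,M)\cdot g(X)=g(M^{-1}X_\sigma)$, where $X_\sigma=(x_{i\sigma(j)})_{i,j}$. For a symmetric polynomial $f\in\mathbb{K}[x_{11},\dots,x_{1n}]$ in the first row of variables, let the polarization module $\mathcal{M}_f$ generated by $f$ be the smallest $\mathbb{K}$-subspace of $\mathbb{K}[X]$ that contains $\{\sigma\cdot f : \sigma\in\mathfrak{S}_n\}$, is closed under all partial derivatives $\partial_{ij}=\partial/\partial x_{ij}$, and is closed under all generalized polarization operators $E_{i,k}^{(p)}=\sum_{j=1}^n x_{ij}\,\partial_{kj}^{\,p}$ with $1\le i,k\le \ell$ and $p\ge 1$. Let $p_d=\sum_{j=1}^n x_{1j}^d$. If $f\in\mathbb{K}[x_{11},\dots,x_{1n}]$ is a nonzero homogeneous symmetric polynomial of degree $2$,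 then $\mathcal{M}_f$ is isomorphic, as an $\mathfrak{S}_n\times GL_\ell(\mathbb{K})$-module, to $\mathcal{M}_{p_1^2}$ or to $\mathcal{M}_{p_2}$. (In particular these subspaces are stable under the action of $\mathfrak{S}_n\times GL_\ell(\mathbb{K})$.) -/

import Mathlib

open MvPolynomial

noncomputable section

namespace PolarizationModule

/-- The ring `𝕂[X]` of polynomials in the entries `x_{ij}` of an `ℓ × n` matrix of variables. -/
abbrev PolyRing (𝕂 : Type*) [Field 𝕂] (ℓ n : ℕ) : Type _ := MvPolynomial (Fin ℓ × Fin n) 𝕂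

/-- The diagonal action of a permutation: `x_{ij} ↦ x_{iσ(j)}`. -/
def columnPerm (𝕂 : Type*) [Field 𝕂] (ℓ n : ℕ) (σ : Equiv.Perm (Fin n)) :
    PolyRing 𝕂 ℓ n →ₐ[𝕂] PolyRing 𝕂 ℓ n :=
  rename fun ij => (ij.1, σ ij.2)

/-- The substitution `X ↦ A X`, that is `x_{ij} ↦ ∑ₖ a_{ik} x_{kj}`. -/
def rowSubst (𝕂 : Type*) [Field 𝕂] (ℓ n : ℕ) (A : Matrix (Fin ℓ) (Fin ℓ) 𝕂) :
    PolyRing 𝕂 ℓ n →ₐ[𝕂] PolyRing 𝕂 ℓ n :=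
  aeval fun ij => ∑ k : Fin ℓ, C (A ij.1 k) * X (k, ij.2)

theorem columnPerm_one (𝕂 : Type*) [Field 𝕂] (ℓ n : ℕ) :
    columnPerm 𝕂 ℓ n 1 = AlgHom.id 𝕂 _ := by
  ext ij : 1
  simp [columnPerm]

theorem columnPerm_mul (𝕂 : Type*) [Field 𝕂] (ℓ n : ℕ) (σ τ : Equiv.Perm (Fin n)) :
    columnPerm 𝕂 ℓ n (σ * τ) = (columnPerm 𝕂 ℓ n σ).comp (columnPerm 𝕂 ℓ n τ) := by
  ext ij : 1
  simp [columnPerm]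

theorem rowSubst_one (𝕂 : Type*) [Field 𝕂] (ℓ n : ℕ) :
    rowSubst 𝕂 ℓ n 1 = AlgHom.id 𝕂 _ := by
  ext ij : 1
  simp [rowSubst, Matrix.one_apply]

theorem rowSubst_mul (𝕂 : Type*) [Field 𝕂] (ℓ n : ℕ) (A B : Matrix (Fin ℓ) (Fin ℓ) 𝕂) :
    rowSubst 𝕂 ℓ n (A * B) = (rowSubst 𝕂 ℓ n B).comp (rowSubst 𝕂 ℓ n A) := by
  ext ij : 1
  simp only [rowSubst, aeval_X, AlgHom.comp_apply, map_sum, map_mul, algHom_C, Matrix.mul_apply,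
    Finset.mul_sum, Finset.sum_mul, MvPolynomial.algebraMap_eq]
  rw [Finset.sum_comm]
  simp only [mul_assoc]

theorem columnPerm_comm_rowSubst (𝕂 : Type*) [Field 𝕂] (ℓ n : ℕ) (σ : Equiv.Perm (Fin n))
    (A : Matrix (Fin ℓ) (Fin ℓ) 𝕂) :
    (columnPerm 𝕂 ℓ n σ).comp (rowSubst 𝕂 ℓ n A) =
      (rowSubst 𝕂 ℓ n A).comp (columnPerm 𝕂 ℓ n σ) := by
  ext ij : 1
  simp [rowSubst, columnPerm]

/-- The representation of `𝔖ₙ × GL_ℓ(𝕂)` on `𝕂[X]` given by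
`(σ, M) · f(X) = f(M⁻¹ X_σ)`, where `X_σ = (x_{iσ(j)})`. -/
def matrixRep (𝕂 : Type*) [Field 𝕂] (ℓ n : ℕ) :
    Representation 𝕂 (Equiv.Perm (Fin n) × GL (Fin ℓ) 𝕂) (PolyRing 𝕂 ℓ n) where
  toFun g := ((columnPerm 𝕂 ℓ n g.1).comp
    (rowSubst 𝕂 ℓ n (↑g.2⁻¹ : Matrix (Fin ℓ) (Fin ℓ) 𝕂))).toLinearMap
  map_one' := by
    rw [Prod.fst_one, Prod.snd_one, inv_one, Units.val_one, rowSubst_one, columnPerm_one]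
    rfl
  map_mul' g h := by
    rw [Prod.fst_mul, Prod.snd_mul, mul_inv_rev, Units.val_mul, rowSubst_mul, columnPerm_mul,
      AlgHom.comp_assoc, ← AlgHom.comp_assoc (columnPerm 𝕂 ℓ n h.1),
      columnPerm_comm_rowSubst 𝕂 ℓ n h.1, AlgHom.comp_assoc, ← AlgHom.comp_assoc]
    rfl

/-- The generalized polarization operator `E_{i,k}^{(p)} = ∑ⱼ x_{ij} ∂_{kj}^p`. -/
def polarization {𝕂 : Type*} [Field 𝕂] {ℓ n : ℕ} (i k : Fin ℓ) (p : ℕ) (g : PolyRing 𝕂 ℓ n) :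
    PolyRing 𝕂 ℓ n :=
  ∑ j : Fin n, X (i, j) * (pderiv (k, j))^[p] g

/-- A subspace is closed under derivatives if it is stable under every `∂_{ij}`. -/
def ClosedUnderDerivatives {𝕂 : Type*} [Field 𝕂] {ℓ n : ℕ}
    (V : Submodule 𝕂 (PolyRing 𝕂 ℓ n)) : Prop :=
  ∀ g ∈ V, ∀ (i : Fin ℓ) (j : Fin n), pderiv (i, j) g ∈ V

/-- A subspace is closed under polarization if it is stable under every `E_{i,k}^{(p)}`, `p ≥ 1`. -/
def ClosedUnderPolarization {𝕂 : Type*} [Field 𝕂] {ℓ n : ℕ}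
    (V : Submodule 𝕂 (PolyRing 𝕂 ℓ n)) : Prop :=
  ∀ g ∈ V, ∀ (i k : Fin ℓ) (p : ℕ), 1 ≤ p → polarization i k p g ∈ V

/-- The polarization module generated by a family `F`: the smallest subspace containing `F` that is
closed under derivatives and closed under polarization. -/
def polarizationModule {𝕂 : Type*} [Field 𝕂] {ℓ n : ℕ} (F : Set (PolyRing 𝕂 ℓ n)) :
    Submodule 𝕂 (PolyRing 𝕂 ℓ n) :=
  sInf {V | ClosedUnderDerivatives V ∧ ClosedUnderPolarization V ∧ F ⊆ V}

/-- The polynomial `f(x_{11}, …, x_{1n})` in the first row of variables. -/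
def firstRow {𝕂 : Type*} [Field 𝕂] (ℓ : ℕ) [NeZero ℓ] {n : ℕ} (f : MvPolynomial (Fin n) 𝕂) :
    PolyRing 𝕂 ℓ n :=
  rename (fun j => ((0 : Fin ℓ), j)) f

/-- The polarization module `𝓜_f` generated by the diagonal `𝔖ₙ`-orbit of `f(x_{11}, …, x_{1n})`. -/
def polarizationModuleOf {𝕂 : Type*} [Field 𝕂] (ℓ : ℕ) [NeZero ℓ] {n : ℕ}
    (f : MvPolynomial (Fin n) 𝕂) : Submodule 𝕂 (PolyRing 𝕂 ℓ n) :=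
  polarizationModule (Set.range fun σ : Equiv.Perm (Fin n) => columnPerm 𝕂 ℓ n σ (firstRow ℓ f))

/-- Two subspaces of `𝕂[X]` are isomorphic as `𝔖ₙ × GL_ℓ(𝕂)`-modules: both are stable under the
action, and there is an equivariant linear isomorphism between them. -/
def IsomorphicModules {𝕂 : Type*} [Field 𝕂] {ℓ n : ℕ}
    (V W : Submodule 𝕂 (PolyRing 𝕂 ℓ n)) : Prop :=
  ∃ V' W' : Subrepresentation (matrixRep 𝕂 ℓ n), V'.toSubmodule = V ∧ W'.toSubmodule = W ∧
    Nonempty (V'.toRepresentation.Equiv W'.toRepresentation)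

end PolarizationModule

end

/-!
By Euler's identity, twice a symmetric quadratic form is `a p₁² + b p₂`, and scaling does not change
the polarization module. If the form is a multiple of `p₁²` we are done. Otherwise `b ≠ 0` and
`n ≥ 2`, and the polarization module is spanned by `1`, all the variables and the polarizations
`a Sᵢ Sₖ + b Pᵢₖ`, where `Sᵢ = ∑ⱼ x_{ij}` and `Pᵢₖ = ∑ⱼ x_{ij} x_{kj}`.

The parameter `a` can be changed by an equivariant transvection `1 + t ψ`. Take a vector `w` with
`∑ wⱼ = 0`, for instance `(1, -1, 0, …, 0)`, and let `ψ` be the quadratic part of the substitution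
`x_{ij} ↦ wⱼ Sᵢ`. It kills constants, linear forms and every `Sᵢ Sₖ`, and maps `Pᵢₖ` to
`(∑ wⱼ²) Sᵢ Sₖ`. Hence `ψ² = 0` on the module, and `1 + t ψ` is injective there; a suitable `t`
moves `a` to `0`, which gives the polarization module of `p₂`.
-/

namespace PolarizationModule

noncomputable section

section SymmetricQuadratics

theorem sum_X_mul_X_mul_pderiv_pderiv {σ R : Type*} [Fintype σ] [CommSemiring R]
    {f : MvPolynomial σ R} {d : ℕ} (hf : f.IsHomogeneous d) :
    ∑ j, ∑ i, X i * X j * pderiv i (pderiv j f) = (d * (d - 1)) • f := by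
  have euler_pderiv (j : σ) : ∑ i, X i * pderiv i (pderiv j f) = (d - 1) • pderiv j f :=
    hf.pderiv.sum_X_mul_pderiv
  calc ∑ j, ∑ i, X i * X j * pderiv i (pderiv j f)
      = ∑ j, X j * ∑ i, X i * pderiv i (pderiv j f) := by
        simp only [Finset.mul_sum, mul_left_comm, mul_assoc]
    _ = (d - 1) • ∑ j, X j * pderiv j f := by
        simp only [euler_pderiv, mul_smul_comm, Finset.smul_sum]
    _ = (d * (d - 1)) • f := by rw [hf.sum_X_mul_pderiv, smul_smul, mul_comm]

theorem pderiv_pderiv_eq_C {σ R : Type*} [CommSemiring R] {f : MvPolynomial σ R}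
    (hf : f.IsHomogeneous 2) (i j : σ) :
    pderiv i (pderiv j f) = C (coeff 0 (pderiv i (pderiv j f))) :=
  totalDegree_eq_zero_iff_eq_C.1 <|
    (totalDegree_zero_iff_isHomogeneous _).2 hf.pderiv.pderiv

theorem pderiv_pderiv_perm {σ R : Type*} [CommSemiring R] {f : MvPolynomial σ R}
    (hf : f.IsSymmetric) (e : Equiv.Perm σ) (i j : σ) :
    pderiv (e i) (pderiv (e j) f) = rename e (pderiv i (pderiv j f)) := by
  rw [← pderiv_rename e.injective, ← pderiv_rename e.injective, hf e]

theorem exists_eq_add_ite_of_perm_invariant {σ M : Type*} [DecidableEq σ] [AddCommGroup M]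
    {h : σ → σ → M} (hh : ∀ (e : Equiv.Perm σ) i j, h (e i) (e j) = h i j) :
    ∃ a b, ∀ i j, h i j = a + if i = j then b else 0 := by
  obtain ⟨c, hc⟩ : ∃ c, ∀ i, h i i = c := by
    cases isEmpty_or_nonempty σ with
    | inl _ => exact ⟨0, isEmptyElim⟩
    | inr hσ =>
      obtain ⟨k⟩ := hσ
      exact ⟨h k k, fun i => by simpa using hh (Equiv.swap k i) k k⟩
  obtain ⟨a, ha⟩ : ∃ a, ∀ i j, i ≠ j → h i j = a := by
    cases subsingleton_or_nontrivial σ with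
    | inl _ => exact ⟨0, fun i j hij => (hij (Subsingleton.elim i j)).elim⟩
    | inr hσ =>
      obtain ⟨k, l, hkl⟩ := exists_pair_ne σ
      refine ⟨h k l, fun i j hij => ?_⟩
      obtain ⟨e, rfl, rfl⟩ := MulAction.is_two_pretransitive_iff.1
        (Equiv.Perm.isMultiplyPretransitive σ 2) hkl hij
      exact hh e k l
  refine ⟨a, c - a, fun i j => ?_⟩
  split_ifs with hij
  · rw [hij, hc, add_sub_cancel]
  · rw [ha i j hij, add_zero]

/-- The symmetric quadratic form `a p₁² + b p₂`. -/
def quadSymm (σ : Type*) [Fintype σ] {R : Type*} [CommSemiring R] (a b : R) : MvPolynomial σ R :=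
  a • psum σ R 1 ^ 2 + b • psum σ R 2

theorem isSymmetric_quadSymm {σ R : Type*} [Fintype σ] [CommSemiring R] (a b : R) :
    (quadSymm σ a b).IsSymmetric := fun e => by
  simp only [quadSymm, map_add, map_smul, map_pow, rename_psum]

theorem two_smul_eq_quadSymm {σ R : Type*} [Fintype σ] [CommRing R] {f : MvPolynomial σ R}
    (hsymm : f.IsSymmetric) (hhom : f.IsHomogeneous 2) : ∃ a b, (2 : R) • f = quadSymm σ a b := by
  classical
  obtain ⟨a, b, hab⟩ := exists_eq_add_ite_of_perm_invariant
    (h := fun i j => coeff 0 (pderiv i (pderiv j f))) fun e i j => by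
      have h := pderiv_pderiv_perm hsymm e i j
      rwa [pderiv_pderiv_eq_C hhom, pderiv_pderiv_eq_C hhom i, rename_C, C_inj] at h
  have second_partials (i j : σ) : pderiv i (pderiv j f) = C a + if i = j then C b else 0 := by
    rw [pderiv_pderiv_eq_C hhom, hab, C_add, apply_ite C, C_0]
  refine ⟨a, b, ?_⟩
  calc (2 : R) • f
      = ∑ j, ∑ i, X i * X j * pderiv i (pderiv j f) := by
        rw [sum_X_mul_X_mul_pderiv_pderiv hhom, ofNat_smul_eq_nsmul]
    _ = (∑ j, ∑ i, X i * X j * C a) + ∑ j, X j * X j * C b := by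
        simp only [second_partials, mul_add, Finset.sum_add_distrib, mul_ite, mul_zero,
          Finset.sum_ite_eq', Finset.mem_univ, if_true]
    _ = quadSymm σ a b := by
        simp only [quadSymm, psum, pow_one, sq, Finset.sum_mul_sum]
        simp only [smul_eq_C_mul, mul_comm (C _), Finset.sum_mul]
        rw [Finset.sum_comm]

end SymmetricQuadratics

section Derivatives

variable {𝕂 : Type*} [Field 𝕂] {ℓ n : ℕ}

/-- The sum `Sᵢ = ∑ⱼ x_{ij}` of the variables in row `i`. -/
def rowSum (𝕂 : Type*) [Field 𝕂] {ℓ : ℕ} (n : ℕ) (i : Fin ℓ) : PolyRing 𝕂 ℓ n :=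
  ∑ j : Fin n, X (i, j)

/-- The polarization `a Sᵢ Sₖ + b ∑ⱼ x_{ij} x_{kj}` of the quadratic form `a p₁² + b p₂`. -/
def quad (n : ℕ) (a b : 𝕂) (i k : Fin ℓ) : PolyRing 𝕂 ℓ n :=
  a • (rowSum 𝕂 n i * rowSum 𝕂 n k) + b • ∑ j : Fin n, X (i, j) * X (k, j)

theorem isHomogeneous_rowSum (i : Fin ℓ) : (rowSum 𝕂 n i).IsHomogeneous 1 :=
  IsHomogeneous.sum _ _ _ fun _ _ => isHomogeneous_X _ _

theorem isHomogeneous_quad (a b : 𝕂) (i k : Fin ℓ) : (quad n a b i k).IsHomogeneous 2 := by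
  rw [quad, smul_eq_C_mul, smul_eq_C_mul]
  exact (((isHomogeneous_rowSum i).mul (isHomogeneous_rowSum k)).C_mul a).add
    ((IsHomogeneous.sum _ _ _ fun _ _ => (isHomogeneous_X _ _).mul (isHomogeneous_X _ _)).C_mul b)

theorem pderiv_X_pair (i k : Fin ℓ) (t j : Fin n) :
    pderiv (k, j) (X (i, t) : PolyRing 𝕂 ℓ n) = if i = k then (if t = j then 1 else 0) else 0 := by
  simp only [pderiv_X, Pi.single_apply, Prod.mk.injEq, ite_and]

theorem pderiv_rowSum (i k : Fin ℓ) (j : Fin n) :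
    pderiv (k, j) (rowSum 𝕂 n i) = if i = k then 1 else 0 := by
  simp only [rowSum, map_sum, pderiv_X_pair]
  split_ifs <;> simp

theorem pderiv_quad (a b : 𝕂) (i k m : Fin ℓ) (j : Fin n) :
    pderiv (m, j) (quad n a b i k) =
      (if i = m then a • rowSum 𝕂 n k + b • X (k, j) else 0) +
        if k = m then a • rowSum 𝕂 n i + b • X (i, j) else 0 := by
  simp only [quad, map_add, Derivation.map_smul, Derivation.leibniz, pderiv_rowSum, map_sum,
    pderiv_X_pair, smul_eq_mul]
  split_ifs <;> simp only [mul_ite, mul_one, mul_zero, Finset.sum_add_distrib, Finset.sum_ite_eq',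
    Finset.mem_univ, if_true, Finset.sum_const_zero] <;> module

theorem pderiv_pderiv_quad (a b : 𝕂) (i k m : Fin ℓ) (j : Fin n) :
    pderiv (m, j) (pderiv (m, j) (quad n a b i k)) =
      if i = m ∧ k = m then C (2 * (a + b)) else 0 := by
  rw [pderiv_quad]
  by_cases hi : i = m <;> by_cases hk : k = m <;>
    simp [hi, hk, pderiv_rowSum, smul_eq_C_mul, two_mul]

theorem iterate_pderiv_eq_zero {σ R : Type*} [CommSemiring R] {f : MvPolynomial σ R} {d p : ℕ}
    (hf : f.IsHomogeneous d) (hdp : d < p) (s : σ) : (pderiv s)^[p] f = 0 := by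
  induction p generalizing d f with
  | zero => exact absurd hdp d.not_lt_zero
  | succ p ih =>
    rw [Function.iterate_succ_apply]
    obtain rfl | hd := d.eq_zero_or_pos
    · rw [totalDegree_eq_zero_iff_eq_C.1 ((totalDegree_zero_iff_isHomogeneous _).2 hf), pderiv_C,
        iterate_map_zero]
    · exact ih hf.pderiv (by lia)

end Derivatives

section Polarization

variable {𝕂 : Type*} [Field 𝕂] {ℓ n : ℕ}

/-- The operator `E_{i,k}^{(p)}` as a linear map. -/
def polarizationLinear (i k : Fin ℓ) (p : ℕ) : PolyRing 𝕂 ℓ n →ₗ[𝕂] PolyRing 𝕂 ℓ n :=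
  ∑ j : Fin n, LinearMap.mulLeft 𝕂 (X (i, j)) ∘ₗ (pderiv (k, j)).toLinearMap ^ p

theorem polarizationLinear_apply (i k : Fin ℓ) (p : ℕ) (g : PolyRing 𝕂 ℓ n) :
    polarizationLinear i k p g = polarization i k p g := by
  simp [polarizationLinear, polarization, LinearMap.sum_apply, Module.End.pow_apply]

theorem polarization_eq_zero {g : PolyRing 𝕂 ℓ n} {d p : ℕ} (hg : g.IsHomogeneous d)
    (hdp : d < p) (i k : Fin ℓ) : polarization i k p g = 0 := by
  simp only [polarization, iterate_pderiv_eq_zero hg hdp, mul_zero, Finset.sum_const_zero]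

theorem polarization_one_rowSum (i k m : Fin ℓ) :
    polarization i k 1 (rowSum 𝕂 n m) = if m = k then rowSum 𝕂 n i else 0 := by
  simp only [polarization, Function.iterate_one, pderiv_rowSum]
  split_ifs <;> simp [rowSum]

theorem polarization_one_X (i k m : Fin ℓ) (t : Fin n) :
    polarization i k 1 (X (m, t) : PolyRing 𝕂 ℓ n) = if m = k then X (i, t) else 0 := by
  simp only [polarization, Function.iterate_one, pderiv_X_pair]
  split_ifs <;> simp

theorem sum_X_mul_pderiv_form (a b : 𝕂) (i k : Fin ℓ) :
    ∑ j : Fin n, X (i, j) * (a • rowSum 𝕂 n k + b • X (k, j)) = quad n a b i k := by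
  simp only [mul_add, Finset.sum_add_distrib, mul_smul_comm, ← Finset.smul_sum, ← Finset.sum_mul,
    quad, rowSum]

theorem polarization_one_quad (a b : 𝕂) (i k m r : Fin ℓ) :
    polarization i k 1 (quad n a b m r) =
      (if m = k then quad n a b i r else 0) + if r = k then quad n a b i m else 0 := by
  simp only [polarization, Function.iterate_one, pderiv_quad, mul_add, Finset.sum_add_distrib]
  congr 1 <;> split_ifs <;> simp [← sum_X_mul_pderiv_form a b i]

theorem polarization_two_quad (a b : 𝕂) (i k m r : Fin ℓ) :
    polarization i k 2 (quad n a b m r) =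
      if m = k ∧ r = k then (2 * (a + b)) • rowSum 𝕂 n i else 0 := by
  simp only [polarization, Function.iterate_succ, Function.iterate_zero, Function.comp_apply, id,
    pderiv_pderiv_quad]
  split_ifs
  · rw [rowSum, smul_eq_C_mul, ← Finset.sum_mul, mul_comm]
  · simp

end Polarization

section QuadSpan

variable {𝕂 : Type*} [Field 𝕂] {ℓ n : ℕ}

/-- The span of `1`, the row sums, the multiples `b x_{ij}` of the variables and the forms
`quad n a b i k`. The factor `b` is there so that for `b = 0` the single variables are left out. -/
def quadSpan (ℓ n : ℕ) (a b : 𝕂) : Submodule 𝕂 (PolyRing 𝕂 ℓ n) :=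
  Submodule.span 𝕂 ({1} ∪ Set.range (rowSum 𝕂 n) ∪
    Set.range (fun ij : Fin ℓ × Fin n => b • (X ij : PolyRing 𝕂 ℓ n)) ∪
    Set.range (fun ik : Fin ℓ × Fin ℓ => quad n a b ik.1 ik.2))

theorem quadSpan_le_iff {a b : 𝕂} {V : Submodule 𝕂 (PolyRing 𝕂 ℓ n)} :
    quadSpan ℓ n a b ≤ V ↔ 1 ∈ V ∧ (∀ i, rowSum 𝕂 n i ∈ V) ∧
      (∀ i j, b • (X (i, j) : PolyRing 𝕂 ℓ n) ∈ V) ∧ ∀ i k, quad n a b i k ∈ V := by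
  simp only [quadSpan, Submodule.span_le, Set.union_subset_iff, Set.singleton_subset_iff,
    Set.range_subset_iff, SetLike.mem_coe, Prod.forall, and_assoc]

theorem one_mem_quadSpan (a b : 𝕂) : (1 : PolyRing 𝕂 ℓ n) ∈ quadSpan ℓ n a b :=
  (quadSpan_le_iff.1 le_rfl).1

theorem rowSum_mem_quadSpan (a b : 𝕂) (i : Fin ℓ) : rowSum 𝕂 n i ∈ quadSpan ℓ n a b :=
  (quadSpan_le_iff.1 le_rfl).2.1 i

theorem smul_X_mem_quadSpan (a b : 𝕂) (i : Fin ℓ) (j : Fin n) :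
    b • (X (i, j) : PolyRing 𝕂 ℓ n) ∈ quadSpan ℓ n a b :=
  (quadSpan_le_iff.1 le_rfl).2.2.1 i j

theorem quad_mem_quadSpan (a b : 𝕂) (i k : Fin ℓ) : quad n a b i k ∈ quadSpan ℓ n a b :=
  (quadSpan_le_iff.1 le_rfl).2.2.2 i k

theorem closedUnderDerivatives_quadSpan (a b : 𝕂) :
    ClosedUnderDerivatives (quadSpan ℓ n a b) := by
  suffices h : ∀ (i : Fin ℓ) (j : Fin n),
      quadSpan ℓ n a b ≤ (quadSpan ℓ n a b).comap (pderiv (i, j)).toLinearMap from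
    fun g hg i j => h i j hg
  intro i j
  have linear_mem (k : Fin ℓ) : a • rowSum 𝕂 n k + b • X (k, j) ∈ quadSpan ℓ n a b :=
    add_mem (Submodule.smul_mem _ _ (rowSum_mem_quadSpan a b k)) (smul_X_mem_quadSpan a b k j)
  simp only [quadSpan_le_iff, Submodule.mem_comap, map_smul, Derivation.coeFn_coe,
    Derivation.map_one_eq_zero, pderiv_rowSum, pderiv_X_pair, pderiv_quad]
  refine ⟨zero_mem _, fun k => ?_, fun k t => Submodule.smul_mem _ _ ?_, fun k m => add_mem ?_ ?_⟩
    <;> split_ifs <;> first | exact zero_mem _ | exact one_mem_quadSpan a b | exact linear_mem _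

theorem closedUnderPolarization_quadSpan (a b : 𝕂) :
    ClosedUnderPolarization (quadSpan ℓ n a b) := by
  suffices h : ∀ (i k : Fin ℓ) (p : ℕ), 1 ≤ p →
      quadSpan ℓ n a b ≤ (quadSpan ℓ n a b).comap (polarizationLinear i k p) from
    fun g hg i k p hp => polarizationLinear_apply i k p g ▸ h i k p hp hg
  intro i k p hp
  have mem_of_degree_lt {g : PolyRing 𝕂 ℓ n} {d : ℕ} (hg : g.IsHomogeneous d) (hdp : d < p) :
      polarization i k p g ∈ quadSpan ℓ n a b :=
    polarization_eq_zero hg hdp i k ▸ zero_mem _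
  simp only [quadSpan_le_iff, Submodule.mem_comap, map_smul, polarizationLinear_apply]
  obtain rfl | hp1 := hp.eq_or_lt
  · simp only [polarization_one_rowSum, polarization_one_X, polarization_one_quad, smul_ite,
      smul_zero]
    refine ⟨mem_of_degree_lt (isHomogeneous_one _ _) hp, fun m => ?_, fun m t => ?_,
      fun m r => add_mem ?_ ?_⟩ <;> split_ifs
    exacts [rowSum_mem_quadSpan a b i, zero_mem _, smul_X_mem_quadSpan a b i t, zero_mem _,
      quad_mem_quadSpan a b i r, zero_mem _, quad_mem_quadSpan a b i m, zero_mem _]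
  · refine ⟨mem_of_degree_lt (isHomogeneous_one _ _) hp,
      fun m => mem_of_degree_lt (isHomogeneous_rowSum m) hp1,
      fun m t => Submodule.smul_mem _ _ (mem_of_degree_lt (isHomogeneous_X _ _) hp1),
      fun m r => ?_⟩
    obtain rfl | hp2 := (Nat.succ_le_of_lt hp1).eq_or_lt
    · rw [polarization_two_quad]
      split_ifs
      exacts [Submodule.smul_mem _ _ (rowSum_mem_quadSpan a b i), zero_mem _]
    · exact mem_of_degree_lt (isHomogeneous_quad a b m r) hp2

theorem quad_mem_of_closedUnderPolarization [NeZero (2 : 𝕂)] {a b : 𝕂}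
    {V : Submodule 𝕂 (PolyRing 𝕂 ℓ n)} (hV : ClosedUnderPolarization V) {m : Fin ℓ}
    (hm : quad n a b m m ∈ V) (i k : Fin ℓ) : quad n a b i k ∈ V := by
  have quad_left_mem (i : Fin ℓ) : quad n a b i m ∈ V := by
    have h := hV _ hm i m 1 le_rfl
    rw [polarization_one_quad, if_pos rfl, ← two_smul 𝕂] at h
    exact (V.smul_mem_iff two_ne_zero).1 h
  have h := hV _ (quad_left_mem k) i m 1 le_rfl
  rw [polarization_one_quad, if_pos rfl] at h
  split_ifs at h with hkm
  · exact hkm ▸ quad_left_mem i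
  · rwa [zero_add] at h

theorem rowSum_mem_of_quad_mem [NeZero (2 : 𝕂)] {a b : 𝕂} (hab : a + b ≠ 0 ∨ n * a + b ≠ 0)
    {V : Submodule 𝕂 (PolyRing 𝕂 ℓ n)} (hd : ClosedUnderDerivatives V)
    (hp : ClosedUnderPolarization V) {i : Fin ℓ} (hi : quad n a b i i ∈ V) :
    rowSum 𝕂 n i ∈ V := by
  obtain h | h := hab
  · have h2 := hp _ hi i i 2 one_le_two
    rw [polarization_two_quad, if_pos ⟨rfl, rfl⟩] at h2
    exact (V.smul_mem_iff (mul_ne_zero two_ne_zero h)).1 h2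
  · have sum_pderiv : ∑ j, pderiv (i, j) (quad n a b i i) =
        (2 * (n * a + b)) • rowSum 𝕂 n i := by
      simp only [pderiv_quad, if_true, Finset.sum_add_distrib, Finset.sum_const, Finset.card_univ,
        Fintype.card_fin, ← Finset.smul_sum, ← Nat.cast_smul_eq_nsmul 𝕂]
      rw [show ∑ j, X (i, j) = rowSum 𝕂 n i from rfl]
      module
    have h2 : ∑ j, pderiv (i, j) (quad n a b i i) ∈ V := sum_mem fun j _ => hd _ hi i j
    rw [sum_pderiv] at h2
    exact (V.smul_mem_iff (mul_ne_zero two_ne_zero h)).1 h2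

theorem quadSpan_le_of_closed [NeZero (2 : 𝕂)] (hn : n ≠ 0) {a b : 𝕂}
    (hab : a + b ≠ 0 ∨ n * a + b ≠ 0) {V : Submodule 𝕂 (PolyRing 𝕂 ℓ n)}
    (hd : ClosedUnderDerivatives V) (hp : ClosedUnderPolarization V) {m : Fin ℓ}
    (hm : quad n a b m m ∈ V) : quadSpan ℓ n a b ≤ V := by
  have quad_mem := quad_mem_of_closedUnderPolarization hp hm
  have rowSum_mem (i : Fin ℓ) : rowSum 𝕂 n i ∈ V := rowSum_mem_of_quad_mem hab hd hp (quad_mem i i)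
  refine quadSpan_le_iff.2 ⟨?_, rowSum_mem, fun i j => ?_, quad_mem⟩
  · have h := hd _ (rowSum_mem m) m ⟨0, Nat.pos_of_ne_zero hn⟩
    rwa [pderiv_rowSum, if_pos rfl] at h
  · have h := hd _ (quad_mem i i) i j
    rw [pderiv_quad, if_pos rfl, ← two_smul 𝕂, V.smul_mem_iff two_ne_zero] at h
    exact (V.add_mem_iff_right (V.smul_mem a (rowSum_mem i))).1 h

end QuadSpan

section PolarizationModuleOf

variable {𝕂 : Type*} [Field 𝕂] {ℓ n : ℕ} [NeZero ℓ]

theorem columnPerm_firstRow (σ : Equiv.Perm (Fin n)) (f : MvPolynomial (Fin n) 𝕂) :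
    columnPerm 𝕂 ℓ n σ (firstRow ℓ f) = firstRow ℓ (rename σ f) := by
  simp only [columnPerm, firstRow, rename_rename, Function.comp_def]

theorem polarizationModuleOf_eq_of_isSymmetric {f : MvPolynomial (Fin n) 𝕂} (hf : f.IsSymmetric) :
    polarizationModuleOf ℓ f = polarizationModule {firstRow ℓ f} := by
  simp only [polarizationModuleOf, columnPerm_firstRow, hf _, Set.range_const]

theorem polarizationModuleOf_smul {c : 𝕂} (hc : c ≠ 0) (f : MvPolynomial (Fin n) 𝕂) :
    polarizationModuleOf ℓ (c • f) = polarizationModuleOf ℓ f := by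
  simp only [polarizationModuleOf, polarizationModule, firstRow, map_smul, Set.range_subset_iff,
    SetLike.mem_coe, Submodule.smul_mem_iff _ hc]

theorem firstRow_quadSymm (a b : 𝕂) :
    firstRow ℓ (quadSymm (Fin n) a b) = quad n a b (0 : Fin ℓ) 0 := by
  simp [firstRow, quadSymm, quad, psum, rowSum, sq]

theorem polarizationModuleOf_quadSymm [NeZero (2 : 𝕂)] (hn : n ≠ 0) {a b : 𝕂}
    (hab : a + b ≠ 0 ∨ n * a + b ≠ 0) :
    polarizationModuleOf ℓ (quadSymm (Fin n) a b) = quadSpan ℓ n a b := by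
  rw [polarizationModuleOf_eq_of_isSymmetric (isSymmetric_quadSymm a b), firstRow_quadSymm]
  refine le_antisymm (sInf_le ⟨closedUnderDerivatives_quadSpan a b,
    closedUnderPolarization_quadSpan a b, ?_⟩) (le_sInf fun V hV => ?_)
  · exact Set.singleton_subset_iff.2 (quad_mem_quadSpan a b 0 0)
  · exact quadSpan_le_of_closed hn hab hV.1 hV.2.1 (Set.singleton_subset_iff.1 hV.2.2)

end PolarizationModuleOf

section GroupAction

variable {𝕂 : Type*} [Field 𝕂] {ℓ n : ℕ} (g : Equiv.Perm (Fin n) × GL (Fin ℓ) 𝕂)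

theorem matrixRep_one_apply : matrixRep 𝕂 ℓ n g 1 = 1 :=
  map_one ((columnPerm 𝕂 ℓ n g.1).comp (rowSubst 𝕂 ℓ n ↑g.2⁻¹))

theorem matrixRep_mul_apply (u v : PolyRing 𝕂 ℓ n) :
    matrixRep 𝕂 ℓ n g (u * v) = matrixRep 𝕂 ℓ n g u * matrixRep 𝕂 ℓ n g v :=
  map_mul ((columnPerm 𝕂 ℓ n g.1).comp (rowSubst 𝕂 ℓ n ↑g.2⁻¹)) u v

theorem matrixRep_X (i : Fin ℓ) (j : Fin n) :
    matrixRep 𝕂 ℓ n g (X (i, j)) = ∑ k, g.2⁻¹ i k • X (k, g.1 j) := by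
  change columnPerm 𝕂 ℓ n g.1 (rowSubst 𝕂 ℓ n _ (X (i, j))) = _
  simp [rowSubst, columnPerm, smul_eq_C_mul]

theorem matrixRep_rowSum (i : Fin ℓ) :
    matrixRep 𝕂 ℓ n g (rowSum 𝕂 n i) = ∑ k, g.2⁻¹ i k • rowSum 𝕂 n k := by
  simp only [rowSum, map_sum, matrixRep_X, Finset.smul_sum]
  rw [Finset.sum_comm]
  exact Finset.sum_congr rfl fun k _ => Equiv.sum_comp g.1 fun j => g.2⁻¹ i k • X (k, j)

theorem matrixRep_sum_X_mul_X (i k : Fin ℓ) :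
    matrixRep 𝕂 ℓ n g (∑ j, X (i, j) * X (k, j)) =
      ∑ m, ∑ r, (g.2⁻¹ i m * g.2⁻¹ k r) • ∑ j, X (m, j) * X (r, j) := by
  simp only [map_sum, matrixRep_mul_apply, matrixRep_X, Finset.sum_mul_sum, smul_mul_smul_comm,
    Finset.smul_sum]
  rw [Finset.sum_comm]
  refine Finset.sum_congr rfl fun m _ => ?_
  rw [Finset.sum_comm]
  exact Finset.sum_congr rfl fun r _ =>
    Equiv.sum_comp g.1 fun j => (g.2⁻¹ i m * g.2⁻¹ k r) • (X (m, j) * X (r, j))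

theorem matrixRep_quad (a b : 𝕂) (i k : Fin ℓ) :
    matrixRep 𝕂 ℓ n g (quad n a b i k) =
      ∑ m, ∑ r, (g.2⁻¹ i m * g.2⁻¹ k r) • quad n a b m r := by
  rw [quad, map_add, map_smul, map_smul, matrixRep_mul_apply, matrixRep_rowSum, matrixRep_rowSum,
    matrixRep_sum_X_mul_X, Finset.sum_mul_sum]
  simp only [quad, smul_mul_smul_comm, smul_add, Finset.sum_add_distrib, Finset.smul_sum,
    smul_comm a, smul_comm b]

theorem matrixRep_mem_quadSpan (a b : 𝕂) {v : PolyRing 𝕂 ℓ n} (hv : v ∈ quadSpan ℓ n a b) :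
    matrixRep 𝕂 ℓ n g v ∈ quadSpan ℓ n a b := by
  suffices h : quadSpan ℓ n a b ≤ (quadSpan ℓ n a b).comap (matrixRep 𝕂 ℓ n g) from h hv
  simp only [quadSpan_le_iff, Submodule.mem_comap, map_smul, matrixRep_one_apply, matrixRep_rowSum,
    matrixRep_X, matrixRep_quad, Finset.smul_sum]
  refine ⟨one_mem_quadSpan a b, fun i => sum_mem fun k _ => ?_, fun i j => sum_mem fun k _ => ?_,
    fun i k => sum_mem fun m _ => sum_mem fun r _ => ?_⟩
  · exact Submodule.smul_mem _ _ (rowSum_mem_quadSpan a b k)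
  · rw [smul_comm]
    exact Submodule.smul_mem _ _ (smul_X_mem_quadSpan a b k _)
  · exact Submodule.smul_mem _ _ (quad_mem_quadSpan a b m r)

/-- `quadSpan ℓ n a b` as a subrepresentation of `𝕂[X]`. -/
def quadSubrep (ℓ n : ℕ) (a b : 𝕂) : Subrepresentation (matrixRep 𝕂 ℓ n) where
  toSubmodule := quadSpan ℓ n a b
  apply_mem_toSubmodule g _ hv := matrixRep_mem_quadSpan g a b hv

theorem isomorphicModules_quadSpan_self (a b : 𝕂) :
    IsomorphicModules (quadSpan ℓ n a b) (quadSpan ℓ n a b) :=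
  ⟨quadSubrep ℓ n a b, quadSubrep ℓ n a b, rfl, rfl, ⟨Representation.Equiv.refl _⟩⟩

end GroupAction

section Transvection

theorem nonempty_equiv_of_map_eq {k G E : Type*} [CommRing k] [Monoid G] [AddCommGroup E]
    [Module k E] {ρ : Representation k G E} {V W : Subrepresentation ρ} (φ : E →ₗ[k] E)
    (hφ : ∀ g, ∀ v ∈ V.toSubmodule, φ (ρ g v) = ρ g (φ v))
    (hinj : ∀ v ∈ V.toSubmodule, φ v = 0 → v = 0) (hmap : V.toSubmodule.map φ = W.toSubmodule) :
    Nonempty (V.toRepresentation.Equiv W.toRepresentation) := by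
  have mapsTo : ∀ v ∈ V.toSubmodule, φ v ∈ W.toSubmodule := fun v hv =>
    hmap ▸ Submodule.mem_map_of_mem hv
  have bijective : Function.Bijective (φ.restrict mapsTo) := by
    refine ⟨(injective_iff_map_eq_zero _).2 fun v hv => ?_, fun w => ?_⟩
    · exact Subtype.ext (hinj v v.2 (congrArg Subtype.val hv))
    · obtain ⟨v, hv, hvw⟩ := hmap.ge w.2
      exact ⟨⟨v, hv⟩, Subtype.ext hvw⟩
  exact ⟨Representation.Equiv.mk (LinearEquiv.ofBijective _ bijective) fun g =>
    LinearMap.ext fun v => Subtype.ext (hφ g v v.2)⟩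

variable {𝕂 : Type*} [Field 𝕂] {ℓ n : ℕ}

/-- The quadratic part of the substitution `x_{ij} ↦ wⱼ Sᵢ`, which replaces column `j` by `wⱼ` times
the sum of all columns. -/
def quadCollapse (ℓ : ℕ) {n : ℕ} (w : Fin n → 𝕂) : PolyRing 𝕂 ℓ n →ₗ[𝕂] PolyRing 𝕂 ℓ n :=
  homogeneousComponent 2 ∘ₗ
    (aeval fun ij => w ij.2 • rowSum 𝕂 n ij.1 : PolyRing 𝕂 ℓ n →ₐ[𝕂] PolyRing 𝕂 ℓ n).toLinearMap

theorem quadCollapse_one (w : Fin n → 𝕂) : quadCollapse ℓ w 1 = 0 := by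
  simp [quadCollapse, homogeneousComponent_of_mem (isHomogeneous_one (Fin ℓ × Fin n) 𝕂)]

theorem quadCollapse_X (w : Fin n → 𝕂) (ij : Fin ℓ × Fin n) : quadCollapse ℓ w (X ij) = 0 := by
  simp [quadCollapse, homogeneousComponent_of_mem (isHomogeneous_rowSum (𝕂 := 𝕂) (n := n) ij.1)]

theorem quadCollapse_rowSum (w : Fin n → 𝕂) (i : Fin ℓ) :
    quadCollapse ℓ w (rowSum 𝕂 n i) = 0 := by
  simp only [rowSum, map_sum, quadCollapse_X, Finset.sum_const_zero]

theorem quadCollapse_quad (w : Fin n → 𝕂) (a b : 𝕂) (i k : Fin ℓ) :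
    quadCollapse ℓ w (quad n a b i k) =
      (a * (∑ j, w j) ^ 2 + b * ∑ j, w j ^ 2) • quad n 1 0 i k := by
  let φ : PolyRing 𝕂 ℓ n →ₐ[𝕂] PolyRing 𝕂 ℓ n := aeval fun ij => w ij.2 • rowSum 𝕂 n ij.1
  have map_rowSum (i : Fin ℓ) : φ (rowSum 𝕂 n i) = (∑ j, w j) • rowSum 𝕂 n i := by
    rw [Finset.sum_smul]
    simp only [φ, rowSum, map_sum, aeval_X]
  have map_sum_X_mul_X : φ (∑ j, X (i, j) * X (k, j)) =
      (∑ j, w j ^ 2) • (rowSum 𝕂 n i * rowSum 𝕂 n k) := by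
    simp only [φ, map_sum, map_mul, aeval_X, smul_mul_smul_comm, ← Finset.sum_smul, ← sq]
  have component_eq : homogeneousComponent 2 (rowSum 𝕂 n i * rowSum 𝕂 n k) =
      rowSum 𝕂 n i * rowSum 𝕂 n k :=
    homogeneousComponent_eq_self ((isHomogeneous_rowSum i).mul (isHomogeneous_rowSum k))
  change homogeneousComponent 2 (φ (quad n a b i k)) = _
  rw [quad, map_add, map_smul, map_smul, map_mul, map_rowSum, map_rowSum, map_sum_X_mul_X,
    smul_mul_smul_comm, map_add, map_smul, map_smul, map_smul, map_smul, component_eq, quad]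
  module

theorem quadCollapse_matrixRep (w : Fin n → 𝕂) {a b : 𝕂}
    (g : Equiv.Perm (Fin n) × GL (Fin ℓ) 𝕂) {v : PolyRing 𝕂 ℓ n} (hv : v ∈ quadSpan ℓ n a b) :
    quadCollapse ℓ w (matrixRep 𝕂 ℓ n g v) = matrixRep 𝕂 ℓ n g (quadCollapse ℓ w v) := by
  suffices h : quadSpan ℓ n a b ≤ LinearMap.eqLocus (quadCollapse ℓ w ∘ₗ matrixRep 𝕂 ℓ n g)
      (matrixRep 𝕂 ℓ n g ∘ₗ quadCollapse ℓ w) from h hv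
  simp only [quadSpan_le_iff, LinearMap.mem_eqLocus, LinearMap.comp_apply, map_smul, map_sum,
    matrixRep_one_apply, matrixRep_X, matrixRep_rowSum, matrixRep_quad, quadCollapse_one,
    quadCollapse_X, quadCollapse_rowSum, quadCollapse_quad, map_zero, smul_zero,
    Finset.sum_const_zero, Finset.smul_sum, implies_true, true_and]
  exact fun i k => Finset.sum_congr rfl fun m _ => Finset.sum_congr rfl fun r _ => smul_comm _ _ _

theorem quadCollapse_quadCollapse {w : Fin n → 𝕂} (hw : ∑ j, w j = 0) {a b : 𝕂}
    {v : PolyRing 𝕂 ℓ n} (hv : v ∈ quadSpan ℓ n a b) :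
    quadCollapse ℓ w (quadCollapse ℓ w v) = 0 := by
  suffices h : quadSpan ℓ n a b ≤ LinearMap.ker (quadCollapse ℓ w ∘ₗ quadCollapse ℓ w) from h hv
  simp [quadSpan_le_iff, quadCollapse_one, quadCollapse_X, quadCollapse_rowSum, quadCollapse_quad,
    hw]

theorem map_id_add_smul_quadCollapse {w : Fin n → 𝕂} (hw : ∑ j, w j = 0) (a b t : 𝕂) :
    (quadSpan ℓ n a b).map (LinearMap.id + t • quadCollapse ℓ w) =
      quadSpan ℓ n (a + t * (b * ∑ j, w j ^ 2)) b := by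
  have image_quad (i k : Fin ℓ) : quad n a b i k + t • quadCollapse ℓ w (quad n a b i k) =
      quad n (a + t * (b * ∑ j, w j ^ 2)) b i k := by
    rw [quadCollapse_quad, hw]
    simp only [quad]
    module
  simp only [quadSpan, Submodule.map_span, Set.image_union, Set.image_singleton, ← Set.range_comp,
    Function.comp_def, LinearMap.add_apply, LinearMap.smul_apply, LinearMap.id_apply, map_smul,
    quadCollapse_one, quadCollapse_X, quadCollapse_rowSum, image_quad, smul_zero, add_zero]

theorem isomorphicModules_quadSpan_add {w : Fin n → 𝕂} (hw : ∑ j, w j = 0) (a b t : 𝕂) :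
    IsomorphicModules (quadSpan ℓ n a b) (quadSpan ℓ n (a + t * (b * ∑ j, w j ^ 2)) b) := by
  refine ⟨quadSubrep ℓ n a b, quadSubrep ℓ n _ b, rfl, rfl, nonempty_equiv_of_map_eq
    (LinearMap.id + t • quadCollapse ℓ w) (fun g v hv => ?_) (fun v hv h => ?_)
    (map_id_add_smul_quadCollapse hw a b t)⟩
  · simp only [LinearMap.add_apply, LinearMap.smul_apply, LinearMap.id_apply, map_add, map_smul,
      quadCollapse_matrixRep w g hv]
  · rw [LinearMap.add_apply, LinearMap.smul_apply, LinearMap.id_apply] at h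
    have collapse_eq_zero : quadCollapse ℓ w v = 0 := by
      simpa [quadCollapse_quadCollapse hw hv] using congrArg (quadCollapse ℓ w) h
    rwa [collapse_eq_zero, smul_zero, add_zero] at h

theorem isomorphicModules_quadSpan [NeZero (2 : 𝕂)] (hn : 2 ≤ n) {b : 𝕂} (hb : b ≠ 0) (a c : 𝕂) :
    IsomorphicModules (quadSpan ℓ n a b) (quadSpan ℓ n c b) := by
  obtain ⟨w, sum_w, sum_sq_w⟩ : ∃ w : Fin n → 𝕂, ∑ j, w j = 0 ∧ ∑ j, w j ^ 2 = 2 := by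
    obtain ⟨n, rfl⟩ := Nat.exists_eq_add_of_le' hn
    refine ⟨Fin.cons 1 (Fin.cons (-1) 0), ?_, ?_⟩ <;> simp [Fin.sum_univ_succ, one_add_one_eq_two]
  convert isomorphicModules_quadSpan_add sum_w a b ((c - a) / (b * 2)) using 2
  rw [sum_sq_w, div_mul_cancel₀ _ (mul_ne_zero hb two_ne_zero), add_sub_cancel]

end Transvection

section Classification

variable {𝕂 : Type*} [Field 𝕂] [NeZero (2 : 𝕂)] {ℓ n : ℕ} [NeZero ℓ]

theorem isomorphicModules_smul_psum_one_sq (hn : n ≠ 0) {c : 𝕂} (hc : c ≠ 0) :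
    IsomorphicModules (polarizationModuleOf ℓ (c • psum (Fin n) 𝕂 1 ^ 2))
      (polarizationModuleOf ℓ (psum (Fin n) 𝕂 1 ^ 2)) := by
  have h : psum (Fin n) 𝕂 1 ^ 2 = quadSymm (Fin n) 1 0 := by simp [quadSymm]
  rw [polarizationModuleOf_smul hc, h, polarizationModuleOf_quadSymm hn (by simp)]
  exact isomorphicModules_quadSpan_self 1 0

theorem isomorphicModules_quadSymm_psum_two (hn : 2 ≤ n) (hn' : (n : 𝕂) ≠ 1) (a : 𝕂) {b : 𝕂}
    (hb : b ≠ 0) :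
    IsomorphicModules (polarizationModuleOf ℓ (quadSymm (Fin n) a b))
      (polarizationModuleOf ℓ (psum (Fin n) 𝕂 2)) := by
  have hab : a + b ≠ 0 ∨ n * a + b ≠ 0 := by
    by_contra! h
    have sub_one_mul_eq_zero : ((n : 𝕂) - 1) * a = 0 := by linear_combination h.2 - h.1
    have ha : a = 0 := (mul_eq_zero_iff_left (sub_ne_zero.2 hn')).1 sub_one_mul_eq_zero
    exact hb (by simpa [ha] using h.1)
  have h : quadSymm (Fin n) 0 b = b • psum (Fin n) 𝕂 2 := by simp [quadSymm]
  rw [← polarizationModuleOf_smul hb (psum (Fin n) 𝕂 2), ← h,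
    polarizationModuleOf_quadSymm (by lia) hab,
    polarizationModuleOf_quadSymm (by lia) (by simpa using hb)]
  exact isomorphicModules_quadSpan hn hb a 0

end Classification

end

end PolarizationModule

open PolarizationModule in
theorem mainTheorem7_general {𝕂 : Type*} [Field 𝕂] [NeZero (2 : 𝕂)] {ℓ n : ℕ} [NeZero ℓ]
    (hn : (n : 𝕂) = 1 → n = 1) {f : MvPolynomial (Fin n) 𝕂} (hsymm : f.IsSymmetric)
    (hhom : f.IsHomogeneous 2) (hf : f ≠ 0) :
    IsomorphicModules (polarizationModuleOf ℓ f)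
        (polarizationModuleOf ℓ (psum (Fin n) 𝕂 1 ^ 2)) ∨
      IsomorphicModules (polarizationModuleOf ℓ f)
        (polarizationModuleOf ℓ (psum (Fin n) 𝕂 2)) := by
  obtain ⟨a, b, hab⟩ := two_smul_eq_quadSymm hsymm hhom
  have hq : quadSymm (Fin n) a b ≠ 0 := hab ▸ smul_ne_zero two_ne_zero hf
  have hn0 : n ≠ 0 := by
    rintro rfl
    exact hq (by simp [quadSymm, psum])
  rw [← polarizationModuleOf_smul two_ne_zero f, hab]
  by_cases hc : ∃ c : 𝕂, quadSymm (Fin n) a b = c • psum (Fin n) 𝕂 1 ^ 2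
  · obtain ⟨c, hc⟩ := hc
    exact .inl (hc ▸ isomorphicModules_smul_psum_one_sq hn0 (left_ne_zero_of_smul (hc ▸ hq)))
  · have hb : b ≠ 0 := by
      rintro rfl
      exact hc ⟨a, by simp [quadSymm]⟩
    have hn1 : n ≠ 1 := by
      rintro rfl
      exact hc ⟨a + b, by simp [quadSymm, psum, add_smul]⟩
    exact .inr (isomorphicModules_quadSymm_psum_two (by lia) (hn1 ∘ hn) a hb)

theorem mainTheorem7 {𝕂 : Type*} [Field 𝕂] [CharZero 𝕂] (ℓ n : ℕ) [NeZero ℓ]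
    (f : MvPolynomial (Fin n) 𝕂) (hsymm : f.IsSymmetric) (hhom : f.IsHomogeneous 2)
    (hf : f ≠ 0) :
    PolarizationModule.IsomorphicModules (PolarizationModule.polarizationModuleOf ℓ f)
        (PolarizationModule.polarizationModuleOf ℓ (MvPolynomial.psum (Fin n) 𝕂 1 ^ 2)) ∨
      PolarizationModule.IsomorphicModules (PolarizationModule.polarizationModuleOf ℓ f)
        (PolarizationModule.polarizationModuleOf ℓ (MvPolynomial.psum (Fin n) 𝕂 2)) :=
  mainTheorem7_general Nat.cast_eq_one.1 hsymm hhom hf
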